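/- Let $R$ be a commutative Noetherian ring with identity, $I$ an ideal of $R$, and $M$ a finitely generated $R$-module. For $i\ge 0$ let $H^i_I(M)=\varinjlim_t \operatorname{Ext}^i_R(R/I^t,M)$ denote the $i$-th local cohomology module of $M$ with support in $I$. An $R$-module $N$ is called $I$-cofinite if its support is contained in the set $V(I)$ of prime ideals containing $I$ and $\operatorname{Ext}^j_R(R/I,N)$ is a finitely generated $R$-module for all $j\ge 0$. Suppose there exists an integer $h\ge 0$ such that $H^i_I(M)$ is $I$-cofinite for all $i\ge 0$ with $i\ne h$. Then $H^i_I(M)$ is $I$-cofinite for all $i\ge 0$. -/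

import Mathlib

open CategoryTheory

universe u

/-- A module `N` over a commutative ring `R` is `I`-cofinite if its support is contained in `V(I)`
and the modules `Ext^i_R(R/I, N)` are finitely generated over `R` for all `i ≥ 0`. -/
structure IsCofinite {R : Type u} [CommRing R] (I : Ideal R)
    (N : Type u) [AddCommGroup N] [Module R N] : Prop where
  support_subset : Module.support R N ⊆ PrimeSpectrum.zeroLocus (I : Set R)
  finite_ext : ∀ i : ℕ,
    Module.Finite R (Abelian.Ext (ModuleCat.of R (R ⧸ I)) (ModuleCat.of R N) i)

/-!
The proof works with modules only, by dimension shifting; no spectral sequence is needed.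

Write `Γ N` for the submodule `I.primaryComponent N` of elements killed by a power of `I`. Over a
Noetherian ring, `Γ E` is injective when `E` is (`Module.Injective.primaryComponent`, by Artin-Rees
and Baer's criterion). Two consequences: a module with `Γ N = N` embeds into an injective module
with the same property, so its local cohomology vanishes in positive degrees; and a module with
`Γ N = 0` embeds into an injective module `E` with `Γ E = 0`, for which `Hom(R/I^t, E) = 0` for
all `t`.

Let `E` be such a module containing `N/Γ N`, and let `C` be the cokernel. The long exact sequences
give `H^{i+1}_I(N) ≅ H^{i+1}_I(N/Γ N) ≅ H^i_I(C)` and `Ext^{i+1}(R/I, N/Γ N) ≅ Ext^i(R/I, C)` for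
all `i ≥ 0`, while `Hom(R/I, N/Γ N) = 0` and `H^0_I(N) ≅ Γ N` (`localCohomology.exists_shift`,
`localCohomology.nonempty_linearEquiv_zero`). Passing from `N` to `C` yields, by induction:

* if all `H^i_I(N)` are cofinite, then all `Ext^n(R/I, N)` are finitely generated
  (`localCohomology.hasFiniteExt_of_isCofinite`);
* if all `Ext^n(R/I, N)` are finitely generated and `H^i_I(N)` is cofinite for `i ≠ h`, the same
  holds for `C` with `h - 1` in place of `h`. So one may assume `h = 0`. Then all `H^i_I(C)` are
  cofinite, so the `Ext` modules of `C`, hence those of `N/Γ N`, hence those of `Γ N ≅ H^0_I(N)`,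
  are finitely generated (`localCohomology.isCofinite_of_forall_ne`).

Local cohomology is defined with `Ext` as a left derived functor in the first variable, whereas
cofiniteness and the long exact sequences use the `Ext` of the derived category. The two are
identified, naturally in the first variable, by `ProjectiveResolution.extIsoAbelianExt`.
-/

/-! ### The derived functor Ext and the Ext of the derived category -/

namespace HomologicalComplex

lemma homologyUnop_inv_naturality {ι V : Type*} [Category* V] [Abelian V] {c : ComplexShape ι}
    {K L : HomologicalComplex Vᵒᵖ c} (φ : K ⟶ L) (i : ι) :
    (homologyMap φ i).unop ≫ (K.homologyUnop i).inv =
      (L.homologyUnop i).inv ≫ homologyMap ((unopFunctor _ _).map φ.op) i := by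
  have h := congrArg Quiver.Hom.unop (ShortComplex.homologyOpIso_hom_naturality
    ((shortComplexFunctor V c.symm i).map ((unopFunctor V c).map φ.op)))
  rw [unop_comp, unop_comp] at h
  have h' : (homologyUnop L i).hom ≫ (homologyMap φ i).unop =
      homologyMap ((unopFunctor V c).map φ.op) i ≫ (homologyUnop K i).hom := h
  have key {A B A' B' : V} (a : A ≅ B) (b : A' ≅ B') (u : B ⟶ B') (v : A ⟶ A')
      (w : a.hom ≫ u = v ≫ b.hom) : u ≫ b.inv = a.inv ≫ v := by
    rw [Iso.comp_inv_eq, Category.assoc, ← w, Iso.inv_hom_id_assoc]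
  exact key _ _ _ _ h'

end HomologicalComplex

namespace CategoryTheory.ProjectiveResolution

open Limits Abelian Opposite

variable {R : Type*} [CommRing R] {C : Type*} [Category.{u} C] [Abelian C] [Linear R C]

noncomputable section

section

variable [HasExt.{u} C] {X Y : C} (P : ProjectiveResolution X)

lemma smul_extMk {n : ℕ} (r : R) (f : P.complex.X n ⟶ Y) (m : ℕ) (hm : n + 1 = m)
    (hf : P.complex.d m n ≫ f = 0) :
    r • P.extMk f m hm hf = P.extMk (r • f) m hm (by simp [hf]) := by
  rw [Ext.smul_eq_comp_mk₀, extMk_comp_mk₀]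
  congr 1
  simp

variable (R Y)

/-- The linear map sending a cocycle of `Hom(P, Y)` to its class in `Ext X Y n`. -/
def extMkLinearMap (n : ℕ) :
    LinearMap.ker (Linear.leftComp R Y (P.complex.d (n + 1) n)) →ₗ[R] Abelian.Ext X Y n where
  toFun z := P.extMk z.1 (n + 1) rfl z.2
  map_add' x y := (P.add_extMk x.1 y.1 (n + 1) rfl x.2 y.2).symm
  map_smul' r x := (P.smul_extMk r x.1 (n + 1) rfl x.2).symm

/-- The map from the cycles of the complex `Hom(P, Y)` to `Ext X Y n`, sending a cocycle to its
class. -/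
def cyclesToExt (n : ℕ) :
    (P.complex.linearYonedaObj R Y).cycles n ⟶ ModuleCat.of R (Abelian.Ext X Y n) :=
  ModuleCat.ofHom (P.extMkLinearMap R Y n ∘ₗ
    LinearMap.codRestrict (LinearMap.ker (Linear.leftComp R Y (P.complex.d (n + 1) n)))
      ((P.complex.linearYonedaObj R Y).iCycles n).hom (fun z =>
        ConcreteCategory.congr_hom ((P.complex.linearYonedaObj R Y).iCycles_d n (n + 1)) z))

variable {R Y} in
lemma cyclesToExt_apply {n : ℕ} (z : (P.complex.linearYonedaObj R Y).cycles n)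
    (f : P.complex.X n ⟶ Y) (hz : (P.complex.linearYonedaObj R Y).iCycles n z = f)
    (hf : P.complex.d (n + 1) n ≫ f = 0) :
    P.cyclesToExt R Y n z = P.extMk f (n + 1) rfl hf := by
  subst hz; rfl

lemma toCycles_comp_cyclesToExt (i n : ℕ) :
    (P.complex.linearYonedaObj R Y).toCycles i n ≫ P.cyclesToExt R Y n = 0 := by
  by_cases h : i + 1 = n
  · ext (g : P.complex.X i ⟶ Y)
    have e := ConcreteCategory.congr_hom ((P.complex.linearYonedaObj R Y).toCycles_i i n) g
    refine (P.cyclesToExt_apply _ (P.complex.d n i ≫ g) e (by simp)).trans ?_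
    exact (P.extMk_eq_zero_iff _ _ _ _ i h).mpr ⟨g, rfl⟩
  · rw [HomologicalComplex.toCycles_eq_zero _ (by simpa using h), zero_comp]

variable {Y} in
open CochainComplex.HomComplex in
/-- A degree zero cocycle whose class vanishes is zero: there are no coboundaries. -/
lemma eq_zero_of_extMk_eq_zero (f : P.complex.X 0 ⟶ Y) (hf : P.complex.d 1 0 ≫ f = 0)
    (h : P.extMk f 1 rfl hf = 0) : f = 0 := by
  rw [← P.extEquivCohomologyClass.apply_eq_iff_eq, extEquivCohomologyClass_extMk,
    extEquivCohomologyClass_zero, CohomologyClass.mk_eq_zero_iff,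
    Cocycle.toSingleMk_mem_coboundaries_iff _ _ _ _ _ 1 (by lia)] at h
  obtain ⟨g, hg⟩ := h
  have hz : P.cochainComplex.d (-(0 : ℕ)) 1 = 0 :=
    (P.cochainComplex.isZero_of_isStrictlyLE 0 1).eq_of_tgt _ _
  rw [hz, zero_comp] at hg
  rw [← cancel_epi (P.cochainComplexXIso (-(0 : ℕ)) 0 rfl).hom, ← hg, comp_zero]

variable {R Y} in
/-- Cocycles whose class in `Ext X Y n` vanishes are coboundaries. -/
lemma homologyπ_eq_zero_of_cyclesToExt_eq_zero {n : ℕ}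
    (z : (P.complex.linearYonedaObj R Y).cycles n) (hz : P.cyclesToExt R Y n z = 0) :
    (P.complex.linearYonedaObj R Y).homologyπ n z = 0 := by
  let K := P.complex.linearYonedaObj R Y
  have hinj : Function.Injective (K.iCycles n) :=
    (ModuleCat.mono_iff_injective _).mp inferInstance
  obtain ⟨f, hf⟩ : ∃ f : P.complex.X n ⟶ Y, K.iCycles n z = f := ⟨_, rfl⟩
  have hdf : P.complex.d (n + 1) n ≫ f = 0 := by
    rw [← hf]; exact ConcreteCategory.congr_hom (K.iCycles_d n (n + 1)) z
  rw [P.cyclesToExt_apply z f hf hdf] at hz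
  cases n with
  | zero =>
    have : z = 0 := hinj (by
      rw [hf, P.eq_zero_of_extMk_eq_zero f hdf hz, map_zero]; rfl)
    rw [this, map_zero]
  | succ p =>
    obtain ⟨g, hg⟩ := (P.extMk_eq_zero_iff _ _ _ _ p rfl).mp hz
    have e : z = K.toCycles p (p + 1) g := hinj (by
      rw [hf, ← hg]
      exact (ConcreteCategory.congr_hom (K.toCycles_i p (p + 1)) g).symm)
    rw [e]
    exact ConcreteCategory.congr_hom (K.toCycles_comp_homologyπ p (p + 1)) g

/-- The comparison map from the cohomology of `Hom(P, Y)` to `Ext X Y n`. -/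
def homologyToExt (n : ℕ) :
    (P.complex.linearYonedaObj R Y).homology n ⟶ ModuleCat.of R (Abelian.Ext X Y n) :=
  ((P.complex.linearYonedaObj R Y).sc n).descHomology (P.cyclesToExt R Y n)
    (P.toCycles_comp_cyclesToExt R Y _ n)

lemma homologyπ_homologyToExt (n : ℕ) :
    (P.complex.linearYonedaObj R Y).homologyπ n ≫ P.homologyToExt R Y n = P.cyclesToExt R Y n :=
  ((P.complex.linearYonedaObj R Y).sc n).π_descHomology _ _

instance (n : ℕ) : IsIso (P.homologyToExt R Y n) := by
  rw [ConcreteCategory.isIso_iff_bijective]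
  let K := P.complex.linearYonedaObj R Y
  have hπ : Function.Surjective (K.homologyπ n) :=
    (ModuleCat.epi_iff_surjective _).mp inferInstance
  have hcomp (z) : P.homologyToExt R Y n (K.homologyπ n z) = P.cyclesToExt R Y n z :=
    ConcreteCategory.congr_hom (P.homologyπ_homologyToExt R Y n) z
  constructor
  · rw [injective_iff_map_eq_zero]
    intro x hx
    obtain ⟨z, rfl⟩ := hπ x
    rw [hcomp] at hx
    exact P.homologyπ_eq_zero_of_cyclesToExt_eq_zero z hx
  · intro α
    obtain ⟨f, hf, rfl⟩ := P.extMk_surjective α (n + 1) rfl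
    have hf' : K.d n (n + 1) f = 0 := hf
    refine ⟨K.homologyπ n (K.cyclesMk f (n + 1) (by simp) hf'), ?_⟩
    rw [hcomp]
    exact P.cyclesToExt_apply _ f (K.i_cyclesMk f (n + 1) (by simp) hf') hf

end

section

/-- The morphism `Hom(L, Y) ⟶ Hom(K, Y)` of cochain complexes given by precomposition with a
morphism of chain complexes `K ⟶ L`. -/
def linearYonedaMap (R : Type*) [Ring R] [Linear R C] {K L : ChainComplex C ℕ} (φ : K ⟶ L) (Y : C) :
    L.linearYonedaObj R Y ⟶ K.linearYonedaObj R Y :=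
  (HomologicalComplex.unopFunctor _ _).map
    ((((linearYoneda R C).obj Y).rightOp.mapHomologicalComplex _).map φ).op

variable [HasExt.{u} C] (R)

lemma homologyToExt_naturality {X' X : C} (f : X' ⟶ X) (P' : ProjectiveResolution X')
    (P : ProjectiveResolution X) (φ : Hom P' P f) (n : ℕ) (Y : C) :
    HomologicalComplex.homologyMap (linearYonedaMap R φ.hom Y) n ≫ P'.homologyToExt R Y n =
      P.homologyToExt R Y n ≫
        ModuleCat.ofHom ((Ext.mk₀ f).precompOfLinear R Y (zero_add n)) := by
  rw [← cancel_epi (HomologicalComplex.homologyπ _ _),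
    HomologicalComplex.homologyπ_naturality_assoc, homologyπ_homologyToExt,
    ← Category.assoc, homologyπ_homologyToExt]
  ext z
  obtain ⟨g, hg⟩ : ∃ g : P.complex.X n ⟶ Y,
    (P.complex.linearYonedaObj R Y).iCycles n z = g := ⟨_, rfl⟩
  have hdg : P.complex.d (n + 1) n ≫ g = 0 := by
    rw [← hg]
    exact ConcreteCategory.congr_hom ((P.complex.linearYonedaObj R Y).iCycles_d n (n + 1)) z
  have e : (P'.complex.linearYonedaObj R Y).iCycles n
      (HomologicalComplex.cyclesMap (linearYonedaMap R φ.hom Y) n z) = φ.hom.f n ≫ g := by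
    rw [← hg]
    exact ConcreteCategory.congr_hom
      (HomologicalComplex.cyclesMap_i (linearYonedaMap R φ.hom Y) n) z
  refine (P'.cyclesToExt_apply _ _ e (by simp [← φ.hom.comm_assoc, hdg])).trans ?_
  refine (mk₀_comp_extMk g (n + 1) rfl hdg φ).symm.trans ?_
  exact congrArg ((Ext.mk₀ f).comp · (zero_add n)) (P.cyclesToExt_apply z g hg hdg).symm

end

section

variable [EnoughProjectives C]

lemma isoExt_naturality {X' X : C} (f : X' ⟶ X) (P' : ProjectiveResolution X')
    (P : ProjectiveResolution X) (φ : Hom P' P f) (n : ℕ) (Y : C) :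
    ((_root_.Ext R C n).map f.op).app Y ≫ (P'.isoExt n Y).hom =
      (P.isoExt n Y).hom ≫
        HomologicalComplex.homologyMap (linearYonedaMap R φ.hom Y) n := by
  have h := congrArg Quiver.Hom.unop (P'.isoLeftDerivedObj_inv_naturality f P φ.hom
    (by simpa using φ.hom_f_zero_comp_π_f_zero) ((linearYoneda R C).obj Y).rightOp n)
  refine (congrArg (· ≫ (HomologicalComplex.homologyUnop _ n).inv) h).trans ?_
  refine (Category.assoc _ _ _).trans ?_
  refine Eq.trans ?_ (Category.assoc _ _ _).symm
  exact congrArg ((P.isoLeftDerivedObj ((linearYoneda R C).obj Y).rightOp n).inv.unop ≫ ·)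
    (HomologicalComplex.homologyUnop_inv_naturality _ n)

variable [HasExt.{u} C] (R)

/-- The contravariant functor `Ext^n(-, Y)` with values in `R`-modules. -/
def abelianExtFunctor (n : ℕ) (Y : C) : Cᵒᵖ ⥤ ModuleCat R where
  obj X := ModuleCat.of R (Abelian.Ext X.unop Y n)
  map f := ModuleCat.ofHom ((Ext.mk₀ f.unop).precompOfLinear R Y (zero_add n))
  map_id X := by
    ext x
    exact Ext.mk₀_id_comp x
  map_comp f g := by
    ext x
    refine Eq.trans ?_ (Ext.mk₀_comp_mk₀_assoc g.unop f.unop x).symm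
    rfl

/-- The comparison of the derived functor `Ext R C n` with the `Ext`-groups of the derived category,
computed with a projective resolution `P` of the first variable. -/
def isoAbelianExt {X : C} (P : ProjectiveResolution X) (n : ℕ) (Y : C) :
    ((_root_.Ext R C n).obj (op X)).obj Y ≅ ModuleCat.of R (Abelian.Ext X Y n) :=
  P.isoExt n Y ≪≫ asIso (P.homologyToExt R Y n)

/-- The derived functor `Ext R C n` agrees with `Abelian.Ext`, naturally in the first variable. -/
def extIsoAbelianExt (n : ℕ) (Y : C) :
    (_root_.Ext R C n).flip.obj Y ≅ abelianExtFunctor R n Y :=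
  NatIso.ofComponents
    (fun X => isoAbelianExt R (projectiveResolution X.unop) n Y)
    (fun {X X'} f => by
      let P := projectiveResolution X.unop
      let P' := projectiveResolution X'.unop
      let φ : Hom P' P f.unop := ⟨lift f.unop P' P, by
        rw [ChainComplex.single₀_map_f_zero]; exact lift_commutes_zero f.unop P' P⟩
      have h1 := isoExt_naturality (R := R) f.unop P' P φ n Y
      have h2 := homologyToExt_naturality R f.unop P' P φ n Y
      refine (Category.assoc _ _ _).symm.trans ?_
      refine (congrArg (· ≫ P'.homologyToExt R Y n) h1).trans ?_
      refine (Category.assoc _ _ _).trans ?_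
      refine (congrArg ((P.isoExt n Y).hom ≫ ·) h2).trans ?_
      exact (Category.assoc _ _ _).symm)

end
end
end CategoryTheory.ProjectiveResolution

/-! ### Power torsion and injective modules -/

section

variable {R : Type u} [CommRing R] (I : Ideal R)

lemma Ideal.mem_primaryComponent_iff {N : Type*} [AddCommGroup N] [Module R N] {x : N} :
    x ∈ I.primaryComponent N ↔ ∃ t : ℕ, ∀ a ∈ I ^ t, a • x = 0 := by
  simp [Ideal.primaryComponent_mem, Submodule.mem_torsionBySet_iff]

/-- A finitely generated `I`-power torsion submodule is annihilated by a single power of `I`. -/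
lemma Ideal.exists_forall_smul_eq_zero_of_fg {N : Type*} [AddCommGroup N] [Module R N]
    {P : Submodule R N} (hP : P.FG) (h : P ≤ I.primaryComponent N) :
    ∃ t : ℕ, ∀ a ∈ I ^ t, ∀ x ∈ P, a • x = 0 := by
  induction P, hP using Submodule.fg_induction with
  | singleton x =>
    obtain ⟨t, ht⟩ := I.mem_primaryComponent_iff.mp (h (Submodule.mem_span_singleton_self x))
    refine ⟨t, fun a ha y hy => ?_⟩
    obtain ⟨r, rfl⟩ := Submodule.mem_span_singleton.mp hy
    rw [smul_comm, ht a ha, smul_zero]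
  | sup P Q _ _ hP hQ =>
    obtain ⟨s, hs⟩ := hP (le_sup_left.trans h)
    obtain ⟨t, ht⟩ := hQ (le_sup_right.trans h)
    refine ⟨s + t, fun a ha z hz => ?_⟩
    obtain ⟨x, hx, y, hy, rfl⟩ := Submodule.mem_sup.mp hz
    rw [smul_add, hs a (Ideal.pow_le_pow_right (Nat.le_add_right s t) ha) x hx,
      ht a (Ideal.pow_le_pow_right (Nat.le_add_left t s) ha) y hy, add_zero]

/-- Over a Noetherian ring, the `I`-power torsion submodule of an injective module is injective.
By the Artin-Rees lemma, a map from an ideal `A` to the torsion submodule vanishes on `A ∩ I ^ n`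
for some `n`, so it extends to `R ⧸ I ^ n`. -/
theorem Module.Injective.primaryComponent [IsNoetherianRing R] (E : Type u) [AddCommGroup E]
    [Module R E] [Module.Injective R E] : Module.Injective R (I.primaryComponent E) := by
  apply Module.Baer.injective
  intro A g
  -- the image of `g` is killed by a power of `I`
  obtain ⟨k, hk⟩ := I.exists_forall_smul_eq_zero_of_fg
    (P := (⊤ : Submodule R A).map ((I.primaryComponent E).subtype ∘ₗ g))
    ((IsNoetherian.noetherian _).map _) (by rintro _ ⟨x, -, rfl⟩; exact (g x).2)
  obtain ⟨c, hc⟩ := I.exists_pow_inf_eq_pow_smul (M := R) A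
  have hle : I ^ (k + c) ⊓ A ≤ I ^ k • A := by
    have h := hc (k + c) (Nat.le_add_left c k)
    rw [Nat.add_sub_cancel] at h
    simp only [smul_eq_mul, Ideal.mul_top] at h
    rw [h]
    exact Submodule.smul_mono le_rfl inf_le_right
  have hzero : ∀ (x : R) (hx : x ∈ A), x ∈ I ^ (k + c) → (g ⟨x, hx⟩ : E) = 0 := by
    intro x hx hx'
    have hx'' : x ∈ I ^ k • A := hle ⟨hx', hx⟩
    have key : ∀ y ∈ I ^ k • A, ∀ hy : y ∈ A, (g ⟨y, hy⟩ : E) = 0 := by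
      intro y hy
      induction hy using Submodule.smul_induction_on' with
      | smul r hr z hz =>
        intro hy
        have e : (⟨r • z, hy⟩ : A) = r • ⟨z, hz⟩ := rfl
        rw [e, map_smul, Submodule.coe_smul]
        exact hk r hr _ ⟨⟨z, hz⟩, trivial, rfl⟩
      | add y hy z hz ihy ihz =>
        intro h
        have hyA : y ∈ A := Submodule.smul_le_right hy
        have hzA : z ∈ A := Submodule.smul_le_right hz
        have e : (⟨y + z, h⟩ : A) = ⟨y, hyA⟩ + ⟨z, hzA⟩ := rfl
        rw [e, map_add, Submodule.coe_add, ihy, ihz, add_zero]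
    exact key x hx'' hx
  -- hence `g` factors through the image of `A` in `R ⧸ I ^ (k + c)`, and extends from there to `φ`
  let q : A →ₗ[R] R ⧸ I ^ (k + c) := (Submodule.mkQ _) ∘ₗ A.subtype
  let g' : A →ₗ[R] E := (I.primaryComponent E).subtype ∘ₗ g
  have hker : LinearMap.ker q ≤ LinearMap.ker g' := by
    intro x hx
    exact hzero x.1 x.2 ((Submodule.Quotient.mk_eq_zero _).mp hx)
  obtain ⟨φ, hφ⟩ := Module.Injective.out (Q := E) ((LinearMap.ker q).liftQ q le_rfl)
    (LinearMap.ker_eq_bot.mp (Submodule.ker_liftQ_eq_bot' _ _ rfl))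
    ((LinearMap.ker q).liftQ g' hker)
  refine ⟨LinearMap.codRestrict _ (φ ∘ₗ Submodule.mkQ _) fun x => ?_, fun x hx => ?_⟩
  · -- the extension is defined on `R ⧸ I ^ (k + c)`, so its values are torsion
    refine I.mem_primaryComponent_iff.mpr ⟨k + c, fun a ha => ?_⟩
    rw [← map_smul]
    have : (Submodule.mkQ (I ^ (k + c))) (a • x) = 0 :=
      (Submodule.Quotient.mk_eq_zero _).mpr (Ideal.mul_mem_right _ _ ha)
    rw [LinearMap.comp_apply, this, map_zero]
  · exact Subtype.ext (hφ (Submodule.Quotient.mk ⟨x, hx⟩))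

lemma Module.exists_injective_embedding (N : Type u) [AddCommGroup N] [Module R N] :
    ∃ (E : Type u) (_ : AddCommGroup E) (_ : Module R E) (f : N →ₗ[R] E),
      Module.Injective R E ∧ Function.Injective f :=
  let E : ModuleCat.{u} R := CategoryTheory.Injective.under (ModuleCat.of R N)
  have _ : CategoryTheory.Injective (ModuleCat.of R E) :=
    inferInstanceAs (CategoryTheory.Injective (CategoryTheory.Injective.under _))
  ⟨E, inferInstance, inferInstance, (CategoryTheory.Injective.ι (ModuleCat.of R N)).hom,
    Module.injective_module_of_injective_object R E,
    (ModuleCat.mono_iff_injective _).mp inferInstance⟩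

/-- An `I`-power torsion module embeds into an injective module that is `I`-power torsion. -/
lemma Ideal.exists_injective_embedding_of_primaryComponent_eq_top [IsNoetherianRing R]
    (N : Type u) [AddCommGroup N] [Module R N] (hN : I.primaryComponent N = ⊤) :
    ∃ (E : Type u) (_ : AddCommGroup E) (_ : Module R E) (f : N →ₗ[R] E),
      Module.Injective R E ∧ Function.Injective f ∧ I.primaryComponent E = ⊤ := by
  obtain ⟨E, _, _, f, hE, hf⟩ := Module.exists_injective_embedding (R := R) N
  refine ⟨I.primaryComponent E, inferInstance, inferInstance,
    f.codRestrict _ fun x => ?_, Module.Injective.primaryComponent I E, fun x y h => ?_, ?_⟩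
  · obtain ⟨t, ht⟩ := I.mem_primaryComponent_iff.mp (hN ▸ Submodule.mem_top : x ∈ _)
    exact I.mem_primaryComponent_iff.mpr ⟨t, fun a ha => by rw [← map_smul, ht a ha, map_zero]⟩
  · exact hf (congrArg Subtype.val h)
  · rw [eq_top_iff]
    rintro ⟨x, hx⟩ -
    obtain ⟨t, ht⟩ := I.mem_primaryComponent_iff.mp hx
    exact I.mem_primaryComponent_iff.mpr ⟨t, fun a ha => Subtype.ext (ht a ha)⟩

/-- A module without `I`-power torsion embeds into an injective module `E` without `I`-power
torsion: the torsion submodule of any injective module containing it is injective, hence a direct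
summand, and `E` is a complement. -/
lemma Ideal.exists_injective_embedding_of_primaryComponent_eq_bot [IsNoetherianRing R]
    (N : Type u) [AddCommGroup N] [Module R N] (hN : I.primaryComponent N = ⊥) :
    ∃ (E : Type u) (_ : AddCommGroup E) (_ : Module R E) (f : N →ₗ[R] E),
      Module.Injective R E ∧ Function.Injective f ∧ I.primaryComponent E = ⊥ := by
  obtain ⟨E, _, _, f, hE, hf⟩ := Module.exists_injective_embedding (R := R) N
  have hΓ := Module.Injective.primaryComponent I E
  obtain ⟨r, hr⟩ := hΓ.out (I.primaryComponent E).subtype Subtype.val_injective LinearMap.id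
  -- the projection onto the complement `ker r` of the torsion submodule
  let p : E →ₗ[R] LinearMap.ker r :=
    (LinearMap.id - (I.primaryComponent E).subtype ∘ₗ r).codRestrict _ fun x => by
      have := hr (r x)
      simp_all
  refine ⟨LinearMap.ker r, inferInstance, inferInstance, p ∘ₗ f, ⟨?_⟩, ?_, ?_⟩
  · intro X Y _ _ _ _ i hi g
    obtain ⟨h, hh⟩ := hE.out i hi ((LinearMap.ker r).subtype ∘ₗ g)
    refine ⟨p ∘ₗ h, fun x => Subtype.ext ?_⟩
    have e : r (g x : E) = 0 := (g x).2
    rw [LinearMap.comp_apply, hh]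
    change (g x : E) - (r (g x) : E) = g x
    rw [e, Submodule.coe_zero, sub_zero]
  · rw [injective_iff_map_eq_zero]
    intro x hx
    have e : f x = (r (f x) : E) := sub_eq_zero.mp (congrArg Subtype.val hx)
    obtain ⟨t, ht⟩ := I.mem_primaryComponent_iff.mp (r (f x)).2
    have : x ∈ I.primaryComponent N := I.mem_primaryComponent_iff.mpr
      ⟨t, fun a ha => hf (by rw [map_smul, e, ht a ha, map_zero])⟩
    simpa [hN] using this
  · rw [eq_bot_iff]
    rintro ⟨x, hx⟩ h
    obtain ⟨t, ht⟩ := I.mem_primaryComponent_iff.mp h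
    have hx' : x ∈ I.primaryComponent E :=
      I.mem_primaryComponent_iff.mpr ⟨t, fun a ha => congrArg Subtype.val (ht a ha)⟩
    have e := hr ⟨x, hx'⟩
    have hx0 : r x = 0 := hx
    simp only [Submodule.subtype_apply, hx0, LinearMap.id_apply] at e
    exact Subtype.ext (congrArg Subtype.val e).symm

lemma Ideal.primaryComponent_quotient_eq_bot [IsNoetherianRing R]
    (N : Type u) [AddCommGroup N] [Module R N] :
    I.primaryComponent (N ⧸ I.primaryComponent N) = ⊥ := by
  rw [eq_bot_iff]
  intro y hy
  obtain ⟨x, rfl⟩ := Submodule.mkQ_surjective _ y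
  obtain ⟨t, ht⟩ := I.mem_primaryComponent_iff.mp hy
  obtain ⟨s, hs⟩ := I.exists_forall_smul_eq_zero_of_fg
    (P := Submodule.map (LinearMap.toSpanSingleton R N x) (I ^ t))
    ((IsNoetherian.noetherian (I ^ t)).map _) (by
      rintro _ ⟨a, ha, rfl⟩
      exact (Submodule.Quotient.mk_eq_zero (I.primaryComponent N)).mp (ht a ha))
  refine (Submodule.Quotient.mk_eq_zero _).mpr (I.mem_primaryComponent_iff.mpr ⟨s + t, ?_⟩)
  intro a ha
  rw [pow_add] at ha
  induction ha using Submodule.mul_induction_on' with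
  | mem_mul_mem b hb c hc => rw [mul_smul]; exact hs b hb _ ⟨c, hc, rfl⟩
  | add b _ c _ hb hc => rw [add_smul, hb, hc, add_zero]

end

/-! ### Local cohomology as a colimit of Ext modules -/

noncomputable section

open Limits Abelian Opposite ProjectiveResolution

namespace ModuleCat

/-- A natural transformation of filtered diagrams of modules induces an isomorphism on colimits if
its kernel elements vanish eventually and every element of the target lies eventually in its
image. -/
lemma isIso_colimMap {R : Type u} [Ring R] {J : Type} [SmallCategory J] [IsFiltered J]
    {F G : J ⥤ ModuleCat.{u} R} (α : F ⟶ G)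
    (hker : ∀ (j : J) (x : F.obj j), α.app j x = 0 → ∃ (k : J) (f : j ⟶ k), F.map f x = 0)
    (hcoker : ∀ (j : J) (y : G.obj j), ∃ (k : J) (f : j ⟶ k) (x : F.obj k),
      α.app k x = G.map f y) : IsIso (colimMap α) := by
  have := preservesSmallestFilteredColimits_of_preservesFilteredColimits
    (forget (ModuleCat.{u} R))
  have hι (j : J) (x : F.obj j) :
      colimMap α (colimit.ι F j x) = colimit.ι G j (α.app j x) :=
    ConcreteCategory.congr_hom (ι_colimMap α j) x
  have hw {j k : J} (f : j ⟶ k) (x : F.obj j) : colimit.ι F k (F.map f x) = colimit.ι F j x :=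
    ConcreteCategory.congr_hom (colimit.w F f) x
  have hwG {j k : J} (f : j ⟶ k) (x : G.obj j) : colimit.ι G k (G.map f x) = colimit.ι G j x :=
    ConcreteCategory.congr_hom (colimit.w G f) x
  rw [ConcreteCategory.isIso_iff_bijective]
  constructor
  · rw [injective_iff_map_eq_zero]
    intro z hz
    obtain ⟨j, x, rfl⟩ := Concrete.colimit_exists_rep F z
    rw [hι] at hz
    obtain ⟨k, f, hf⟩ := Concrete.colimit_rep_eq_zero R G j _ hz
    have hf' : α.app k (F.map f x) = 0 :=
      (ConcreteCategory.congr_hom (α.naturality f) x).trans hf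
    obtain ⟨l, g, hg⟩ := hker k _ hf'
    rw [← hw f, ← hw g, hg, map_zero]
  · intro z
    obtain ⟨j, y, rfl⟩ := Concrete.colimit_exists_rep G z
    obtain ⟨k, f, x, hx⟩ := hcoker j y
    exact ⟨colimit.ι F k x, by rw [hι, hx, hwG]⟩

end ModuleCat

namespace CategoryTheory.ProjectiveResolution

/-- Postcomposition with a class `Ext Y Z a`, as a natural transformation of functors. -/
def abelianExtPostcomp (R : Type*) [CommRing R] {C : Type*} [Category.{u} C] [Abelian C]
    [Linear R C] [HasExt.{u} C] {Y Z : C} {a : ℕ} (α : Abelian.Ext Y Z a) (n m : ℕ)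
    (h : n + a = m) : abelianExtFunctor R n Y ⟶ abelianExtFunctor R m Z where
  app X := ModuleCat.ofHom (α.postcompOfLinear R X.unop h)
  naturality X X' f := by
    ext x
    exact Ext.comp_assoc (Ext.mk₀ f.unop) x α (zero_add n) h (by lia)

end CategoryTheory.ProjectiveResolution

namespace localCohomology

variable {R : Type u} [CommRing R] (I : Ideal R)

/-- The directed system of the modules `Ext^i(R/I^t, N)`, with `Ext` taken in the sense of
`Abelian.Ext`. -/
def extDiagram (i : ℕ) (N : ModuleCat.{u} R) : ℕᵒᵖᵒᵖ ⥤ ModuleCat.{u} R :=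
  (ringModIdeals (idealPowersDiagram I)).op ⋙ abelianExtFunctor R i N

/-- Local cohomology is the colimit of the modules `Abelian.Ext (R/I^t) N i`. -/
def isoColimitExtDiagram (i : ℕ) (N : ModuleCat.{u} R) :
    (localCohomology I i).obj N ≅ colimit (extDiagram I i N) :=
  colimitObjIsoColimitCompEvaluation (diagram (idealPowersDiagram I) i) N ≪≫
    HasColimit.isoOfNatIso (Functor.isoWhiskerLeft (ringModIdeals (idealPowersDiagram I)).op
      (extIsoAbelianExt R i N))

/-- The module `R/I^t`. -/
abbrev quotPow (t : ℕ) : ModuleCat.{u} R := ModuleCat.of R (R ⧸ I ^ t)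

/-- The projection `R/I^s → R/I^t`, `t ≤ s`. -/
abbrev quotPowMap {t s : ℕ} (h : t ≤ s) : quotPow I s ⟶ quotPow I t :=
  ModuleCat.ofHom (Submodule.mapQ (I ^ s) (I ^ t) LinearMap.id (Ideal.pow_le_pow_right h))

/-- Postcomposition with a class in `Ext^a(Y, Z)` induces an isomorphism `H^i_I(Y) ≅ H^{i+a}_I(Z)`
as soon as it is bijective up to passing from `R/I^t` to some `R/I^s`. -/
lemma nonempty_iso_of_postcomp {i a m : ℕ} {Y Z : ModuleCat.{u} R} (α : Abelian.Ext Y Z a)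
    (h : i + a = m)
    (hker : ∀ (t : ℕ) (x : Abelian.Ext (quotPow I t) Y i), x.comp α h = 0 →
      ∃ (s : ℕ) (hs : t ≤ s), (Ext.mk₀ (quotPowMap I hs)).comp x (zero_add i) = 0)
    (hcoker : ∀ (t : ℕ) (y : Abelian.Ext (quotPow I t) Z m),
      ∃ (s : ℕ) (hs : t ≤ s) (x : Abelian.Ext (quotPow I s) Y i),
        x.comp α h = (Ext.mk₀ (quotPowMap I hs)).comp y (zero_add m)) :
    Nonempty ((localCohomology I i).obj Y ≅ (localCohomology I m).obj Z) := by
  let φ : extDiagram I i Y ⟶ extDiagram I m Z :=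
    Functor.whiskerLeft (ringModIdeals (idealPowersDiagram I)).op
      (abelianExtPostcomp R α i m h)
  have : IsIso (colimMap φ) := by
    apply ModuleCat.isIso_colimMap
    · intro j x hx
      obtain ⟨s, hs, e⟩ := hker j.unop.unop x hx
      exact ⟨op (op s), (homOfLE hs).op.op, e⟩
    · intro j y
      obtain ⟨s, hs, x, e⟩ := hcoker j.unop.unop y
      exact ⟨op (op s), (homOfLE hs).op.op, x, e⟩
  exact ⟨isoColimitExtDiagram I i Y ≪≫ asIso (colimMap φ) ≪≫ (isoColimitExtDiagram I m Z).symm⟩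

end localCohomology

end

/-! ### Local cohomology and short exact sequences -/

noncomputable section

open Limits Abelian Opposite ProjectiveResolution

namespace localCohomology

variable {R : Type u} [CommRing R] (I : Ideal R)

lemma smul_hom_quotient_one_eq_zero (J : Ideal R) {N : ModuleCat.{u} R}
    (f : ModuleCat.of R (R ⧸ J) ⟶ N) : ∀ a ∈ J, a • f (1 : R ⧸ J) = 0 := by
  intro a ha
  rw [← map_smul, Algebra.smul_def, mul_one]
  exact (congrArg f (Ideal.Quotient.eq_zero_iff_mem.mpr ha)).trans (map_zero f.hom)

/-- The morphism `R/J ⟶ N` sending `1` to an element `x` annihilated by `J`. -/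
def quotientHomOfSMulEqZero (J : Ideal R) {N : ModuleCat.{u} R} (x : N)
    (hx : ∀ a ∈ J, a • x = 0) : ModuleCat.of R (R ⧸ J) ⟶ N :=
  ModuleCat.ofHom (J.liftQ (LinearMap.toSpanSingleton R N x) hx)

lemma quotientHomOfSMulEqZero_one (J : Ideal R) {N : ModuleCat.{u} R} (x : N)
    (hx : ∀ a ∈ J, a • x = 0) : quotientHomOfSMulEqZero J x hx (1 : R ⧸ J) = x :=
  one_smul R x

lemma quotient_hom_ext (J : Ideal R) {N : ModuleCat.{u} R} {f g : ModuleCat.of R (R ⧸ J) ⟶ N}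
    (h : f (1 : R ⧸ J) = g (1 : R ⧸ J)) : f = g := by
  apply ModuleCat.hom_ext
  apply Submodule.linearMap_qext
  apply LinearMap.ext_ring
  exact h

lemma quotient_hom_eq_zero {J : Ideal R} {t : ℕ} (hJ : I ^ t ≤ J) {N : ModuleCat.{u} R}
    (hN : I.primaryComponent N = ⊥) (f : ModuleCat.of R (R ⧸ J) ⟶ N) : f = 0 := by
  apply quotient_hom_ext
  have : f (1 : R ⧸ J) ∈ I.primaryComponent N := I.mem_primaryComponent_iff.mpr
    ⟨t, fun a ha => smul_hom_quotient_one_eq_zero J f a (hJ ha)⟩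
  rw [hN] at this
  exact this

/-- The short exact sequence `0 → N → E → E/N → 0` of an injective linear map `N → E`. -/
lemma shortExact_mkQ {N E : Type u} [AddCommGroup N] [Module R N] [AddCommGroup E] [Module R E]
    (f : N →ₗ[R] E) (hf : Function.Injective f) :
    (ShortComplex.mk (ModuleCat.ofHom f) (ModuleCat.ofHom (LinearMap.range f).mkQ)
      (by ext x; exact (Submodule.Quotient.mk_eq_zero _).mpr ⟨x, rfl⟩)).ShortExact where
  exact := by
    rw [ShortComplex.moduleCat_exact_iff]
    intro x hx
    exact (Submodule.Quotient.mk_eq_zero _).mp hx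
  mono_f := (ModuleCat.mono_iff_injective _).mpr hf
  epi_g := (ModuleCat.epi_iff_surjective _).mpr (Submodule.mkQ_surjective _)

/-- The higher local cohomology of an `I`-power torsion module `N` vanishes: each class in
`Ext^{i+1}(R/I^t, N)` dies in some `Ext^{i+1}(R/I^s, N)`. This is shown by dimension shifting along
an embedding of `N` into a torsion injective module. -/
lemma exists_mk₀_comp_eq_zero [IsNoetherianRing R] (i t : ℕ) (N : ModuleCat.{u} R)
    (hN : I.primaryComponent N = ⊤) (x : Abelian.Ext (quotPow I t) N (i + 1)) :
    ∃ (s : ℕ) (hs : t ≤ s), (Ext.mk₀ (quotPowMap I hs)).comp x (zero_add (i + 1)) = 0 := by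
  induction i generalizing N with
  | zero =>
    obtain ⟨E, _, _, f, hE, hf, hΓ⟩ :=
      I.exists_injective_embedding_of_primaryComponent_eq_top N hN
    have := Module.injective_object_of_injective_module R E
    have hS := shortExact_mkQ f hf
    obtain ⟨y, rfl⟩ := Ext.covariant_sequence_exact₁ _ hS x (Ext.eq_zero_of_injective _) rfl
    obtain ⟨y, rfl⟩ := (Ext.mk₀_bijective _ _).2 y
    obtain ⟨e, he⟩ := Submodule.mkQ_surjective _ (y (1 : R ⧸ I ^ t))
    obtain ⟨s, hs⟩ := I.mem_primaryComponent_iff.mp (hΓ ▸ Submodule.mem_top : e ∈ _)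
    refine ⟨t + s, Nat.le_add_right t s, ?_⟩
    have hc : quotPowMap I (Nat.le_add_right t s) ≫ y =
        quotientHomOfSMulEqZero (I ^ (t + s)) (N := ModuleCat.of R E) e (fun a ha => hs a
          (Ideal.pow_le_pow_right (Nat.le_add_left s t) ha)) ≫
            ModuleCat.ofHom (LinearMap.range f).mkQ := by
      apply quotient_hom_ext
      refine he.symm.trans (congrArg (LinearMap.range f).mkQ ?_)
      exact (quotientHomOfSMulEqZero_one _ (N := ModuleCat.of R E) e _).symm
    rw [Ext.mk₀_comp_mk₀_assoc, hc, ← Ext.mk₀_comp_mk₀_assoc, hS.comp_extClass, Ext.comp_zero]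
  | succ i ih =>
    obtain ⟨E, _, _, f, hE, hf, hΓ⟩ :=
      I.exists_injective_embedding_of_primaryComponent_eq_top N hN
    have := Module.injective_object_of_injective_module R E
    have hS := shortExact_mkQ f hf
    obtain ⟨y, rfl⟩ := Ext.covariant_sequence_exact₁ _ hS x (Ext.eq_zero_of_injective _) rfl
    have hΓ' : I.primaryComponent (E ⧸ LinearMap.range f) = ⊤ := by
      rw [eq_top_iff]
      intro z _
      obtain ⟨e, rfl⟩ := Submodule.mkQ_surjective _ z
      obtain ⟨s, hs⟩ := I.mem_primaryComponent_iff.mp (hΓ ▸ Submodule.mem_top : e ∈ _)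
      exact I.mem_primaryComponent_iff.mpr ⟨s, fun a ha => by rw [← map_smul, hs a ha, map_zero]⟩
    obtain ⟨s, hs, e⟩ := ih (ModuleCat.of R (E ⧸ LinearMap.range f)) hΓ' y
    refine ⟨s, hs, ?_⟩
    rw [← Ext.comp_assoc _ _ _ (zero_add (i + 1)) rfl (by lia), e, Ext.zero_comp]

/-- Passing to the quotient by an `I`-power torsion submodule does not change local cohomology in
positive degrees. -/
lemma nonempty_iso_of_torsion_kernel [IsNoetherianRing R] {S : ShortComplex (ModuleCat.{u} R)}
    (hS : S.ShortExact) (hN : I.primaryComponent S.X₁ = ⊤) (i : ℕ) :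
    Nonempty ((localCohomology I (i + 1)).obj S.X₂ ≅ (localCohomology I (i + 1)).obj S.X₃) := by
  refine nonempty_iso_of_postcomp I (Ext.mk₀ S.g) (add_zero _) (fun t x hx => ?_) (fun t y => ?_)
  · obtain ⟨x, rfl⟩ := Ext.covariant_sequence_exact₂ _ hS x hx
    obtain ⟨s, hs, e⟩ := exists_mk₀_comp_eq_zero I i t _ hN x
    refine ⟨s, hs, ?_⟩
    rw [← Ext.comp_assoc _ _ _ (zero_add (i + 1)) _ (by lia), e, Ext.zero_comp]
  · obtain ⟨s, hs, e⟩ := exists_mk₀_comp_eq_zero I (i + 1) t _ hN (y.comp hS.extClass rfl)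
    rw [← Ext.comp_assoc _ _ _ (zero_add (i + 1)) rfl (by lia)] at e
    obtain ⟨x, hx⟩ := Ext.covariant_sequence_exact₃ _ hS _ rfl e
    exact ⟨s, hs, x, hx⟩

/-- Dimension shifting for `Ext(R/J, -)`, where `I ^ t ≤ J`, along an injective module without
`I`-power torsion: then `Hom(R/J, S.X₂) = 0`, so there is no exception in degree zero. -/
lemma postcomp_extClass_bijective {J : Ideal R} {t : ℕ} (hJ : I ^ t ≤ J)
    {S : ShortComplex (ModuleCat.{u} R)} (hS : S.ShortExact)
    (hI : CategoryTheory.Injective S.X₂) (hN : I.primaryComponent S.X₂ = ⊥) (i : ℕ) :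
    Function.Bijective
      (hS.extClass.postcompOfLinear R (ModuleCat.of R (R ⧸ J)) (rfl : i + 1 = i + 1)) := by
  have hz : ∀ y : Abelian.Ext (ModuleCat.of R (R ⧸ J)) S.X₂ i, y = 0 := by
    intro y
    cases i with
    | zero =>
      obtain ⟨f, rfl⟩ := (Ext.mk₀_bijective _ _).2 y
      rw [quotient_hom_eq_zero I hJ hN f, Ext.mk₀_zero]
    | succ i => exact Ext.eq_zero_of_injective y
  constructor
  · rw [injective_iff_map_eq_zero]
    intro x hx
    obtain ⟨y, rfl⟩ := Ext.covariant_sequence_exact₃ _ hS x rfl hx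
    rw [hz y, Ext.zero_comp]
  · intro x
    exact Ext.covariant_sequence_exact₁ _ hS x (Ext.eq_zero_of_injective _) rfl

/-- Dimension shifting for local cohomology along an injective module without `I`-power torsion. -/
lemma nonempty_iso_succ {S : ShortComplex (ModuleCat.{u} R)} (hS : S.ShortExact)
    (hI : CategoryTheory.Injective S.X₂) (hN : I.primaryComponent S.X₂ = ⊥) (i : ℕ) :
    Nonempty ((localCohomology I i).obj S.X₃ ≅ (localCohomology I (i + 1)).obj S.X₁) := by
  refine nonempty_iso_of_postcomp I hS.extClass rfl (fun t x hx => ⟨t, le_rfl, ?_⟩)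
    (fun t y => ⟨t, le_rfl, (postcomp_extClass_bijective I le_rfl hS hI hN i).2 _⟩)
  have : x = 0 := (postcomp_extClass_bijective I le_rfl hS hI hN i).1 (hx.trans (map_zero _).symm)
  rw [this, Ext.comp_zero]

/-- `H^0_I(N)` is the `I`-power torsion submodule of `N`. -/
lemma nonempty_linearEquiv_zero (N : ModuleCat.{u} R) :
    Nonempty ((localCohomology I 0).obj N ≃ₗ[R] I.primaryComponent N) := by
  have := preservesSmallestFilteredColimits_of_preservesFilteredColimits
    (forget (ModuleCat.{u} R))
  -- a morphism `R/I^t ⟶ N` is determined by the image of `1`, a torsion element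
  let ev (t : ℕ) : Abelian.Ext (quotPow I t) N 0 →ₗ[R] I.primaryComponent N :=
    (((LinearMap.applyₗ (1 : R ⧸ I ^ t)).comp ModuleCat.homLinearEquiv.toLinearMap).codRestrict
      (I.primaryComponent N) (fun f => I.mem_primaryComponent_iff.mpr
        ⟨t, smul_hom_quotient_one_eq_zero _ f⟩)).comp (Ext.linearEquiv₀ (R := R)).toLinearMap
  have ev_mk₀ (t : ℕ) (f : quotPow I t ⟶ N) : (ev t (Ext.mk₀ f) : N) = f (1 : R ⧸ I ^ t) := by
    have e : Ext.linearEquiv₀ (R := R) (Ext.mk₀ f) = f :=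
      (Ext.mk₀_bijective _ _).1 (Ext.mk₀_linearEquiv₀_apply _)
    exact congrArg (fun g : quotPow I t ⟶ N => g (1 : R ⧸ I ^ t)) e
  let c : Cocone (extDiagram I 0 N) :=
    { pt := ModuleCat.of R (I.primaryComponent N)
      ι :=
        { app := fun j => ModuleCat.ofHom (ev j.unop.unop)
          naturality := fun j k f => by
            ext x
            obtain ⟨g, rfl⟩ := (Ext.mk₀_bijective (quotPow I j.unop.unop) N).2 x
            refine Subtype.ext ?_
            refine Eq.trans ?_ (ev_mk₀ _ g).symm
            refine Eq.trans ?_ (ev_mk₀ k.unop.unop (quotPowMap I (leOfHom f.unop.unop) ≫ g))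
            exact congrArg (fun y => (ev k.unop.unop y : N)) (Ext.mk₀_comp_mk₀ _ g) } }
  let φ := colimit.desc _ c
  have hφ (j) (x : (extDiagram I 0 N).obj j) :
      φ (colimit.ι (extDiagram I 0 N) j x) = ev j.unop.unop x :=
    ConcreteCategory.congr_hom (colimit.ι_desc c j) x
  have : Function.Bijective φ := by
    constructor
    · rw [injective_iff_map_eq_zero]
      intro z hz
      obtain ⟨j, x, rfl⟩ := Concrete.colimit_exists_rep _ z
      rw [hφ] at hz
      obtain ⟨f, rfl⟩ := (Ext.mk₀_bijective (quotPow I j.unop.unop) N).2 x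
      have hf : f = 0 := quotient_hom_ext _
        ((ev_mk₀ _ f).symm.trans (congrArg Subtype.val hz))
      rw [hf, Ext.mk₀_zero]
      exact map_zero _
    · rintro ⟨x, hx⟩
      obtain ⟨t, ht⟩ := I.mem_primaryComponent_iff.mp hx
      refine ⟨colimit.ι (extDiagram I 0 N) (op (op t))
        (Ext.mk₀ (quotientHomOfSMulEqZero (I ^ t) x ht)), ?_⟩
      refine (hφ _ _).trans ?_
      exact Subtype.ext ((ev_mk₀ _ _).trans (quotientHomOfSMulEqZero_one _ x ht))
  exact ⟨(isoColimitExtDiagram I 0 N).toLinearEquiv.trans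
    (LinearEquiv.ofBijective φ.hom this)⟩

end localCohomology
end

/-! ### Cofinite modules -/

section

open Limits Abelian Opposite

namespace IsCofinite

variable {R : Type u} [CommRing R] {I : Ideal R}

lemma of_linearEquiv {N N' : Type u} [AddCommGroup N] [Module R N] [AddCommGroup N'] [Module R N']
    (e : N ≃ₗ[R] N') (h : IsCofinite I N) : IsCofinite I N' where
  support_subset := e.support_eq ▸ h.support_subset
  finite_ext i := by
    have := h.finite_ext i
    let e' : ModuleCat.of R N ≅ ModuleCat.of R N' := e.toModuleIso
    refine Module.Finite.of_surjective
      ((Ext.mk₀ e'.hom).postcompOfLinear R (ModuleCat.of R (R ⧸ I)) (add_zero i)) fun y => ?_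
    refine ⟨y.comp (Ext.mk₀ e'.inv) (add_zero i), ?_⟩
    change (y.comp (Ext.mk₀ e'.inv) (add_zero i)).comp (Ext.mk₀ e'.hom) (add_zero i) = y
    simp

lemma support_primaryComponent_subset (N : Type u) [AddCommGroup N] [Module R N] :
    Module.support R (I.primaryComponent N) ⊆ PrimeSpectrum.zeroLocus (I : Set R) := by
  intro p hp
  obtain ⟨⟨x, hx⟩, h⟩ := Module.mem_support_iff_exists_annihilator.mp hp
  obtain ⟨t, ht⟩ := I.mem_primaryComponent_iff.mp hx
  rw [PrimeSpectrum.mem_zeroLocus, SetLike.coe_subset_coe]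
  refine p.isPrime.le_of_pow_le (n := t) (le_trans (fun a ha => ?_) h)
  rw [Submodule.mem_annihilator_span_singleton]
  exact Subtype.ext (ht a ha)

lemma primaryComponent_of_localCohomology_zero {N : ModuleCat.{u} R}
    (h : IsCofinite I ((localCohomology I 0).obj N)) : IsCofinite I (I.primaryComponent N) :=
  let ⟨e⟩ := localCohomology.nonempty_linearEquiv_zero I N
  h.of_linearEquiv e

end IsCofinite

namespace localCohomology

variable {R : Type u} [CommRing R]

/-- The short exact sequence `0 → P → N → N/P → 0` of a submodule `P`. -/
lemma shortExact_subtype_mkQ {N : Type u} [AddCommGroup N] [Module R N] (P : Submodule R N) :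
    (ShortComplex.mk (ModuleCat.ofHom P.subtype) (ModuleCat.ofHom P.mkQ)
      (by ext x; exact (Submodule.Quotient.mk_eq_zero _).mpr x.2)).ShortExact where
  exact := by
    rw [ShortComplex.moduleCat_exact_iff]
    intro x hx
    exact ⟨⟨x, (Submodule.Quotient.mk_eq_zero _).mp hx⟩, rfl⟩
  mono_f := (ModuleCat.mono_iff_injective _).mpr P.injective_subtype
  epi_g := (ModuleCat.epi_iff_surjective _).mpr P.mkQ_surjective

/-! ### Finiteness of Ext along short exact sequences -/

variable [IsNoetherianRing R]

lemma finite_of_exact {A B C : Type*} [AddCommGroup A] [Module R A] [AddCommGroup B] [Module R B]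
    [AddCommGroup C] [Module R C] (f : A →ₗ[R] B) (g : B →ₗ[R] C)
    (h : Function.Exact f g) (hA : Module.Finite R A) (hC : Module.Finite R C) :
    Module.Finite R B := by
  have := isNoetherian_of_range_eq_ker f g h.linearMap_ker_eq.symm
  infer_instance

section

variable (X : ModuleCat.{u} R) {S : ShortComplex (ModuleCat.{u} R)}

lemma finite_ext_X₂ (hS : S.ShortExact) (i : ℕ) (h₁ : Module.Finite R (Abelian.Ext X S.X₁ i))
    (h₃ : Module.Finite R (Abelian.Ext X S.X₃ i)) : Module.Finite R (Abelian.Ext X S.X₂ i) :=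
  finite_of_exact ((Ext.mk₀ S.f).postcompOfLinear R X (add_zero i))
    ((Ext.mk₀ S.g).postcompOfLinear R X (add_zero i))
    ((ShortComplex.ab_exact_iff_function_exact _).mp (Ext.covariant_sequence_exact₂' X hS i)) h₁ h₃

lemma finite_ext_X₃ (hS : S.ShortExact) (i : ℕ) (h₂ : Module.Finite R (Abelian.Ext X S.X₂ i))
    (h₁ : Module.Finite R (Abelian.Ext X S.X₁ (i + 1))) :
    Module.Finite R (Abelian.Ext X S.X₃ i) :=
  finite_of_exact ((Ext.mk₀ S.g).postcompOfLinear R X (add_zero i))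
    (hS.extClass.postcompOfLinear R X rfl)
    ((ShortComplex.ab_exact_iff_function_exact _).mp
      (Ext.covariant_sequence_exact₃' X hS i (i + 1) rfl)) h₂ h₁

lemma finite_ext_X₁_succ (hS : S.ShortExact) (i : ℕ) (h₃ : Module.Finite R (Abelian.Ext X S.X₃ i))
    (h₂ : Module.Finite R (Abelian.Ext X S.X₂ (i + 1))) :
    Module.Finite R (Abelian.Ext X S.X₁ (i + 1)) :=
  finite_of_exact (hS.extClass.postcompOfLinear R X rfl)
    ((Ext.mk₀ S.f).postcompOfLinear R X (add_zero (i + 1)))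
    ((ShortComplex.ab_exact_iff_function_exact _).mp
      (Ext.covariant_sequence_exact₁' X hS i (i + 1) rfl)) h₃ h₂

lemma finite_ext_X₁_zero (hS : S.ShortExact) (h₂ : Module.Finite R (Abelian.Ext X S.X₂ 0)) :
    Module.Finite R (Abelian.Ext X S.X₁ 0) := by
  have := hS.mono_f
  exact Module.Finite.of_injective ((Ext.mk₀ S.f).postcompOfLinear R X (add_zero 0))
    (Ext.postcomp_mk₀_injective_of_mono X S.f)

end

/-! ### Dimension shifting of cofiniteness -/

variable (I : Ideal R)

/-- All the modules `Ext^i(R/I, N)` are finitely generated. -/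
def HasFiniteExt (N : ModuleCat.{u} R) : Prop :=
  ∀ i : ℕ, Module.Finite R (Abelian.Ext (ModuleCat.of R (R ⧸ I)) N i)

/-- The shifted module of `N`: with `T` the `I`-power torsion of `N` and `N/T ⊆ E` injective without
torsion, `C = E/(N/T)` has the local cohomology of `N` and the `Ext(R/I, -)` of `N/T`, each moved
down by one degree. -/
lemma exists_shift (N : ModuleCat.{u} R) :
    ∃ C : ModuleCat.{u} R,
      (∀ i, Nonempty ((localCohomology I (i + 1)).obj N ≃ₗ[R] (localCohomology I i).obj C)) ∧
      (∀ i, Nonempty (Abelian.Ext (ModuleCat.of R (R ⧸ I)) C i ≃ₗ[R]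
        Abelian.Ext (ModuleCat.of R (R ⧸ I))
          (ModuleCat.of R (N ⧸ I.primaryComponent N)) (i + 1))) := by
  obtain ⟨E, _, _, f, hE, hf, hΓ⟩ := I.exists_injective_embedding_of_primaryComponent_eq_bot
    (N ⧸ I.primaryComponent N) (I.primaryComponent_quotient_eq_bot N)
  have hI := Module.injective_object_of_injective_module R E
  have hS := shortExact_mkQ f hf
  have hT : I.primaryComponent (I.primaryComponent N) = ⊤ := by
    rw [eq_top_iff]
    rintro ⟨x, hx⟩ -
    obtain ⟨t, ht⟩ := I.mem_primaryComponent_iff.mp hx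
    exact I.mem_primaryComponent_iff.mpr ⟨t, fun a ha => Subtype.ext (ht a ha)⟩
  refine ⟨ModuleCat.of R (E ⧸ LinearMap.range f), fun i => ?_, fun i => ?_⟩
  · obtain ⟨e₁⟩ := nonempty_iso_of_torsion_kernel I
      (shortExact_subtype_mkQ (I.primaryComponent N)) hT i
    obtain ⟨e₂⟩ := nonempty_iso_succ I hS hI hΓ i
    exact ⟨(e₁ ≪≫ e₂.symm).toLinearEquiv⟩
  · exact ⟨LinearEquiv.ofBijective _
      (postcomp_extClass_bijective I (pow_one I).le hS hI hΓ i)⟩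

variable {I}

/-- `Hom(R/I, N/T) = 0` for `T` the `I`-power torsion of `N`. -/
lemma finite_ext_quotient_zero (N : ModuleCat.{u} R) :
    Module.Finite R (Abelian.Ext (ModuleCat.of R (R ⧸ I))
      (ModuleCat.of R (N ⧸ I.primaryComponent N)) 0) := by
  have : Subsingleton (Abelian.Ext (ModuleCat.of R (R ⧸ I))
      (ModuleCat.of R (N ⧸ I.primaryComponent N)) 0) := by
    refine subsingleton_of_forall_eq 0 fun y => ?_
    obtain ⟨f, rfl⟩ := (Ext.mk₀_bijective _ _).2 y
    rw [quotient_hom_eq_zero I (pow_one I).le (I.primaryComponent_quotient_eq_bot N) f,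
      Ext.mk₀_zero]
  infer_instance

/-- If all local cohomology modules of `N` are cofinite, then `N` has finitely generated
`Ext^n(R/I, N)`. Induction on `n`: the torsion submodule `T` is `H^0_I(N)`, and the `Ext` of `N/T`
is that of the shifted module in degree `n - 1`. -/
lemma hasFiniteExt_of_isCofinite (N : ModuleCat.{u} R)
    (h : ∀ i, IsCofinite I ((localCohomology I i).obj N)) : HasFiniteExt I N := by
  intro n
  induction n generalizing N with
  | zero =>
    exact finite_ext_X₂ _ (shortExact_subtype_mkQ (I.primaryComponent N)) 0
      ((h 0).primaryComponent_of_localCohomology_zero.finite_ext 0) (finite_ext_quotient_zero N)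
  | succ n ih =>
    obtain ⟨C, hC, hC'⟩ := exists_shift I N
    have := ih C fun i => (h (i + 1)).of_linearEquiv (hC i).some
    exact finite_ext_X₂ _ (shortExact_subtype_mkQ (I.primaryComponent N)) (n + 1)
      ((h 0).primaryComponent_of_localCohomology_zero.finite_ext _)
      (Module.Finite.equiv (hC' n).some)

/-- If the `Ext^n(R/I, N)` are finitely generated and `H^i_I(N)` is cofinite for `i ≠ h`, then it is
so for all `i`. Replacing `N` by its shifted module reduces the claim to `h = 0`. In that case all
local cohomology of the shifted module is cofinite, so its `Ext` is finitely generated; then `N/T`, and hence `T = H^0_I(N)`, has finitely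
generated `Ext`. -/
theorem isCofinite_of_forall_ne (N : ModuleCat.{u} R) (hN : HasFiniteExt I N) (h : ℕ)
    (hcof : ∀ i, i ≠ h → IsCofinite I ((localCohomology I i).obj N)) :
    ∀ i, IsCofinite I ((localCohomology I i).obj N) := by
  induction h generalizing N with
  | zero =>
    intro i
    rcases Nat.eq_zero_or_pos i with rfl | hi
    · obtain ⟨C, hC, hC'⟩ := exists_shift I N
      have hF := hasFiniteExt_of_isCofinite C fun i =>
        (hcof (i + 1) (Nat.succ_ne_zero i)).of_linearEquiv (hC i).some
      have hQ : HasFiniteExt I (ModuleCat.of R (N ⧸ I.primaryComponent N)) := by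
        rintro (_ | n)
        · exact finite_ext_quotient_zero N
        · have := hF n
          exact Module.Finite.equiv (hC' n).some
      have hS := shortExact_subtype_mkQ (I.primaryComponent N)
      refine IsCofinite.of_linearEquiv (nonempty_linearEquiv_zero I N).some.symm
        ⟨IsCofinite.support_primaryComponent_subset N, ?_⟩
      rintro (_ | n)
      · exact finite_ext_X₁_zero _ hS (hN 0)
      · exact finite_ext_X₁_succ _ hS n (hQ n) (hN (n + 1))
    · exact hcof i hi.ne'
  | succ h ih =>
    obtain ⟨C, hC, hC'⟩ := exists_shift I N
    have hF : HasFiniteExt I C := fun n => by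
      have := finite_ext_X₃ _ (shortExact_subtype_mkQ (I.primaryComponent N)) (n + 1)
        (hN (n + 1))
        ((hcof 0 (Nat.succ_ne_zero h).symm).primaryComponent_of_localCohomology_zero.finite_ext _)
      exact Module.Finite.equiv (hC' n).some.symm
    have key := ih C hF fun i hi =>
      (hcof (i + 1) (fun e => hi (Nat.succ_injective e))).of_linearEquiv (hC i).some
    rintro (_ | i)
    · exact hcof 0 (Nat.succ_ne_zero h).symm
    · exact (key i).of_linearEquiv (hC i).some.symm

end localCohomology

end

theorem mainTheorem6 {R : Type u} [CommRing R] [IsNoetherianRing R] (I : Ideal R)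
    (M : Type u) [AddCommGroup M] [Module R M] [Module.Finite R M] (h : ℕ)
    (hcof : ∀ i : ℕ, i ≠ h → IsCofinite I ((localCohomology I i).obj (ModuleCat.of R M))) :
    ∀ i : ℕ, IsCofinite I ((localCohomology I i).obj (ModuleCat.of R M)) :=
  localCohomology.isCofinite_of_forall_ne (ModuleCat.of R M)
    (fun i => ModuleCat.finite_ext R (ModuleCat.of R (R ⧸ I)) (ModuleCat.of R M) i) h hcof
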